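/- **Theorem 9.1.** Let $n\ge 3$, let $\mathbb P^1=\mathbb C\cup\{\infty\}$, and let $$M_{0,n}=\{X=(x_1,\dots,x_n)\in(\mathbb P^1)^n : x_i\ne x_j \text{ for } i\neq j,\ x_{n-2}=0,\ x_{n-1}=1,\ x_n=\infty\},$$ a complex manifold with coordinates $(x_1,\dots,x_{n-3})$. Let $M_{0,n+1}$ be the space of tuples $x=(x_0,X)$ with $X\in M_{0,n}$ and $x_0\in\mathbb P^1-X:=\mathbb P^1\setminus\{x_1,\dots,x_n\}$. Let $p:M_{0,n+1}\to M_{0,n}$ be the projection $p(x_0,X)=X$, and for fixed $X$ let $i:\mathbb P^1-X\to M_{0,n+1}$ be the inclusion $i(z)=(z,X)$ of the fibre. Fix $x=(x_0,X)\in M_{0,n+1}$ and consider the sequence of groups $$N_x=\pi_1(\mathbb P^1-X,x_0)\xrightarrow{\,i_*\,}K_x=\pi_1(M_{0,n+1},x)\xrightarrow{\,p_*\,}H_X=\pi_1(M_{0,n},X).$$ Let $\mathscr B=([\alpha_1],\dots,[\alpha_n])$ be a geometric basis of $N_x$. That is, the $[\alpha_i]$ generate $N_x$, and they arise as follows. For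 some permutation $\sigma$ there are smooth regular arcs $\tilde\alpha_i$ in $\mathbb P^1$ from $x_0$ to $x_{\sigma(i)}$ that pairwise meet only at $x_0$ and leave $x_0$ in distinct directions, in counterclockwise order. There are also small pairwise disjoint discs around the points $x_{\sigma(i)}$, the $i$-th disc containing no other point of $X$. The loop $\alpha_i$ runs along $\tilde\alpha_i$ until it reaches the boundary of the $i$-th disc, goes around this boundary once counterclockwise, and returns along $\tilde\alpha_i$. Put $\Gamma_n=\langle\gamma_1,\dots,\gamma_n\mid\gamma_1\cdots\gamma_n=1\rangle$ and let $\chi:\Gamma_n\to N_x$ be the isomorphism with $\chi(\gamma_i)=[\alpha_i]$. Let $G$ be a finite group, let $\theta:\Gamma_n\to G$ be an epimorphism with $\theta(\gamma_i)\neq1$ for all $i$, and put $f=\theta\circ\chi^{-1}:N_x\to G$. Let $I(x,\mathscr B,\theta)$ be the set of pairs $a=(H_a,f_a)$, where $H_a\subset H_X$ is a subgroup of finite index and $f_a:p_*^{-1}(H_a)\to G$ is a homomorphism with $f_a\circ i_*=f$. For $a\in I(x,\mathscr B,\theta)$ let $q_a:(Y_a,y_a)\to(M_{0,n},X)$ be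 the connected pointed covering with $q_{a*}\pi_1(Y_a,y_a)=H_a$, where $Y_a$ carries the complex structure that makes $q_a$ locally biholomorphic. It is unique up to pointed isomorphism, and it is the base of the family of $G$-coverings of the line associated with $a$. If $G$ is abelian, then there is an $a\in I(x,\mathscr B,\theta)$ with $H_a=H_X=\pi_1(M_{0,n},X)$. Hence $Y_a=M_{0,n}$, that is, $q_a:Y_a\to M_{0,n}$ is biholomorphic. -/

import Mathlib

open Set Topology
open scoped Manifold ContDiff

noncomputable section

namespace CoverFamily

/-! ### Fundamental groups -/

/-- The fundamental group `π₁(X, x)` in which `[α] * [β]` is the class of the path that runs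
first along `α` and then along `β`. (The product of Mathlib's `FundamentalGroup` is the opposite
one.) -/
abbrev Pi1 (X : Type*) [TopologicalSpace X] (x : X) : Type _ := (FundamentalGroup X x)ᵐᵒᵖ

/-- The class of a loop. -/
def Pi1.mk {X : Type*} [TopologicalSpace X] {x : X} (γ : Path x x) : Pi1 X x :=
  MulOpposite.op (FundamentalGroup.fromPath (Path.Homotopic.Quotient.mk γ))

theorem Pi1.mk_mul_mk {X : Type*} [TopologicalSpace X] {x : X} (γ δ : Path x x) :
    Pi1.mk γ * Pi1.mk δ = Pi1.mk (γ.trans δ) := rfl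

/-- The homomorphism `π₁(X, x) → π₁(Y, y)` induced by a continuous map `f` with `f x = y`. -/
def pi1Map {X Y : Type*} [TopologicalSpace X] [TopologicalSpace Y] (f : C(X, Y)) {x : X} {y : Y}
    (h : f x = y) : Pi1 X x →* Pi1 Y y :=
  MonoidHom.op (FundamentalGroup.mapOfEq f h)

/-! ### The projective line -/

/-- The complex projective line `ℙ¹ = ℂ ∪ {∞}`. -/
abbrev P1 : Type := OnePoint ℂ

/-- The coordinate `z` on `ℙ¹ ∖ {∞}` (with the value `0` at `∞`, where it is not used). -/
def zCoord : P1 → ℂ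
  | none => 0
  | some z => z

/-- The coordinate `w = 1 / z` on `ℙ¹ ∖ {0}`. -/
def wCoord : P1 → ℂ
  | none => 0
  | some z => z⁻¹

open Classical in
/-- The inverse of a holomorphic coordinate centred at `y`: the coordinate is `z - y` if `y` is
finite, and `1 / z` if `y = ∞`. -/
def fromCoord : P1 → ℂ → P1
  | none, ζ => if ζ = 0 then OnePoint.infty else ((ζ⁻¹ : ℂ) : P1)
  | some y, ζ => ((y + ζ : ℂ) : P1)

/-- The closed coordinate disc of radius `r` centred at `y`. -/
def coordDisc (y : P1) (r : ℝ) : Set P1 := fromCoord y '' Metric.closedBall 0 r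

/-- The boundary circle of the coordinate disc of radius `r` centred at `y`. -/
def coordCircle (y : P1) (r : ℝ) : Set P1 := fromCoord y '' Metric.sphere 0 r

/-! ### The spaces `M_{0,n}` and `M_{0,n+1}` -/

/-- `M_{0,n}`: the `n`-tuples `(x₁, …, xₙ)` of distinct points of `ℙ¹` with
`xₙ₋₂ = 0`, `xₙ₋₁ = 1`, `xₙ = ∞`. The index set is `{0, …, n - 1}`. -/
def M0 (n : ℕ) : Type :=
  {X : Fin n → P1 // Function.Injective X ∧ ∀ i : Fin n,
    ((i : ℕ) + 3 = n → X i = ((0 : ℂ) : P1)) ∧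
    ((i : ℕ) + 2 = n → X i = ((1 : ℂ) : P1)) ∧
    ((i : ℕ) + 1 = n → X i = OnePoint.infty)}

instance (n : ℕ) : TopologicalSpace (M0 n) := instTopologicalSpaceSubtype

/-- `M_{0,n+1}`, with points written `(x₀, x₁, …, xₙ)`: the `n + 1`-tuples of distinct points of
`ℙ¹` with `xₙ₋₂ = 0`, `xₙ₋₁ = 1`, `xₙ = ∞`. -/
def M1 (n : ℕ) : Type :=
  {x : Fin (n + 1) → P1 // Function.Injective x ∧ ∀ i : Fin n,
    ((i : ℕ) + 3 = n → x i.succ = ((0 : ℂ) : P1)) ∧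
    ((i : ℕ) + 2 = n → x i.succ = ((1 : ℂ) : P1)) ∧
    ((i : ℕ) + 1 = n → x i.succ = OnePoint.infty)}

instance (n : ℕ) : TopologicalSpace (M1 n) := instTopologicalSpaceSubtype

/-- The projection `p : M_{0,n+1} → M_{0,n}`, `(x₀, X) ↦ X`. -/
def proj (n : ℕ) : C(M1 n, M0 n) where
  toFun x := ⟨fun i => x.1 i.succ, fun _ _ h => Fin.succ_injective n (x.2.1 h), x.2.2⟩
  continuous_toFun := Continuous.subtype_mk
    (continuous_pi fun i => (continuous_apply i.succ).comp continuous_subtype_val) _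

/-- The punctured projective line `ℙ¹ - X`. -/
def Punctured {n : ℕ} (X : M0 n) : Type := {z : P1 // z ∉ range X.1}

instance {n : ℕ} (X : M0 n) : TopologicalSpace (Punctured X) := instTopologicalSpaceSubtype

/-- The point `x₀` of `ℙ¹ - X`, for `x = (x₀, X)` in `M_{0,n+1}`. -/
def basePoint {n : ℕ} (x : M1 n) : Punctured (proj n x) :=
  ⟨x.1 0, by
    rintro ⟨j, hj⟩
    exact Fin.succ_ne_zero j (x.2.1 hj)⟩

/-- The inclusion of the fibre `i : ℙ¹ - X → M_{0,n+1}`, `z ↦ (z, X)`. -/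
def fibreIncl {n : ℕ} (X : M0 n) : C(Punctured X, M1 n) where
  toFun z := ⟨Fin.cons z.1 X.1, Fin.cons_injective_iff.2 ⟨z.2, X.2.1⟩, fun i => by
    simpa using X.2.2 i⟩
  continuous_toFun := Continuous.subtype_mk
    (continuous_pi fun i => by
      refine Fin.cases ?_ (fun j => ?_) i
      · exact (continuous_subtype_val : Continuous (Subtype.val : {z : P1 // z ∉ range X.1} → P1))
      · exact continuous_const) _

theorem fibreIncl_basePoint {n : ℕ} (x : M1 n) : fibreIncl (proj n x) (basePoint x) = x :=
  Subtype.ext (Fin.cons_self_tail x.1)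

/-- `N_x = π₁(ℙ¹ - X, x₀)`. -/
abbrev Nx {n : ℕ} (x : M1 n) : Type := Pi1 (Punctured (proj n x)) (basePoint x)

/-- `K_x = π₁(M_{0,n+1}, x)`. -/
abbrev Kx {n : ℕ} (x : M1 n) : Type := Pi1 (M1 n) x

/-- `H_X = π₁(M_{0,n}, X)`. -/
abbrev HX {n : ℕ} (x : M1 n) : Type := Pi1 (M0 n) (proj n x)

/-- `i_* : N_x → K_x`. -/
def iStar {n : ℕ} (x : M1 n) : Nx x →* Kx x :=
  pi1Map (fibreIncl (proj n x)) (fibreIncl_basePoint x)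

/-- `p_* : K_x → H_X`. -/
def pStar {n : ℕ} (x : M1 n) : Kx x →* HX x := pi1Map (proj n) rfl

/-! ### The complex structure of `M_{0,n}` -/

/-- The coordinates `(x₁, …, xₙ₋₃)` on `M_{0,n}`. -/
def coords (n : ℕ) (X : M0 n) : Fin (n - 3) → ℂ :=
  fun j => zCoord (X.1 (Fin.castLE (Nat.sub_le n 3) j))

/-- `(z₁, …, zₙ₋₃) ↦ (z₁, …, zₙ₋₃, 0, 1, ∞)`. -/
def tuple (n : ℕ) (z : Fin (n - 3) → ℂ) : Fin n → P1 := fun i =>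
  if h : (i : ℕ) + 3 < n then ((z ⟨i, by omega⟩ : ℂ) : P1)
  else if (i : ℕ) + 3 = n then ((0 : ℂ) : P1)
  else if (i : ℕ) + 2 = n then ((1 : ℂ) : P1)
  else OnePoint.infty

theorem coe_zCoord {u : P1} (h : u ≠ OnePoint.infty) : ((zCoord u : ℂ) : P1) = u := by
  induction u using OnePoint.rec with
  | infty => exact absurd rfl h
  | coe z => rfl

theorem ne_infty {n : ℕ} (X : M0 n) (i : Fin n) (h : (i : ℕ) + 1 < n) :
    X.1 i ≠ OnePoint.infty := by
  intro hi
  have h1 := (X.2.2 ⟨n - 1, by omega⟩).2.2 (by simp; omega)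
  have h2 := X.2.1 (hi.trans h1.symm)
  have := congrArg Fin.val h2
  simp at this
  omega

theorem tuple_coords (n : ℕ) (X : M0 n) : tuple n (coords n X) = X.1 := by
  funext i
  unfold tuple
  split_ifs with h h1 h2
  · exact coe_zCoord (ne_infty X i (by omega))
  · exact ((X.2.2 i).1 h1).symm
  · exact ((X.2.2 i).2.1 h2).symm
  · exact ((X.2.2 i).2.2 (by omega)).symm

theorem coords_tuple (n : ℕ) (z : Fin (n - 3) → ℂ) (h : Function.Injective (tuple n z) ∧
    ∀ i : Fin n, ((i : ℕ) + 3 = n → tuple n z i = ((0 : ℂ) : P1)) ∧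
      ((i : ℕ) + 2 = n → tuple n z i = ((1 : ℂ) : P1)) ∧
      ((i : ℕ) + 1 = n → tuple n z i = OnePoint.infty)) :
    coords n ⟨tuple n z, h⟩ = z := by
  funext j
  have : ((Fin.castLE (Nat.sub_le n 3) j : Fin n) : ℕ) + 3 < n := by simp; omega
  simp only [coords, tuple, dif_pos this]
  rfl

theorem continuous_tuple (n : ℕ) : Continuous (tuple n) := by
  refine continuous_pi fun i => ?_
  unfold tuple
  split_ifs
  · exact OnePoint.continuous_coe.comp (continuous_apply _)
  all_goals exact continuous_const

theorem continuous_coords (n : ℕ) : Continuous (coords n) := by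
  refine continuous_pi fun j => ?_
  have hcont : Continuous fun X : M0 n => X.1 (Fin.castLE (Nat.sub_le n 3) j) :=
    (continuous_apply _).comp continuous_subtype_val
  refine (OnePoint.isOpenEmbedding_coe (X := ℂ)).isInducing.continuous_iff.2 ?_
  refine hcont.congr fun X => ?_
  exact (coe_zCoord (ne_infty X _ (by simp; omega))).symm

theorem tuple_fixed (n : ℕ) (z : Fin (n - 3) → ℂ) (i : Fin n) :
    ((i : ℕ) + 3 = n → tuple n z i = ((0 : ℂ) : P1)) ∧
      ((i : ℕ) + 2 = n → tuple n z i = ((1 : ℂ) : P1)) ∧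
      ((i : ℕ) + 1 = n → tuple n z i = OnePoint.infty) := by
  refine ⟨fun hi => ?_, fun hi => ?_, fun hi => ?_⟩ <;> unfold tuple
  · rw [dif_neg (by omega), if_pos hi]
  · rw [dif_neg (by omega), if_neg (by omega), if_pos hi]
  · rw [dif_neg (by omega), if_neg (by omega), if_neg (by omega)]

instance (n : ℕ) : Nonempty (M0 n) := by
  refine ⟨⟨tuple n fun j => (((j : ℕ) + 2 : ℕ) : ℂ), ?_, tuple_fixed n _⟩⟩
  intro i j hij
  unfold tuple at hij
  have key : ∀ a b : ℕ, (((a : ℂ) : P1) = ((b : ℂ) : P1)) → a = b := fun a b h => by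
    exact_mod_cast OnePoint.coe_injective h
  have k0 : ∀ a : ℕ, (((a : ℂ) : P1) = ((0 : ℂ) : P1)) → a = 0 := fun a h => by
    exact_mod_cast OnePoint.coe_injective h
  have k1 : ∀ a : ℕ, (((a : ℂ) : P1) = ((1 : ℂ) : P1)) → a = 1 := fun a h => by
    exact_mod_cast OnePoint.coe_injective h
  have k01 : ((0 : ℂ) : P1) ≠ ((1 : ℂ) : P1) := fun h => by
    simpa using OnePoint.coe_injective h
  apply Fin.ext
  split_ifs at hij <;>
    first
    | omega
    | (have := key _ _ hij; simp at this; omega)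
    | (have := k0 _ hij; simp at this)
    | (have := k0 _ hij.symm; simp at this)
    | (have := k1 _ hij; simp at this)
    | (have := k1 _ hij.symm; simp at this)
    | exact absurd hij k01
    | exact absurd hij.symm k01
    | exact absurd hij (OnePoint.coe_ne_infty _)
    | exact absurd hij.symm (OnePoint.coe_ne_infty _)

theorem isOpenEmbedding_coords (n : ℕ) : IsOpenEmbedding (coords n) := by
  have hcomp : tuple n ∘ coords n = Subtype.val := funext (tuple_coords n)
  have hemb : IsEmbedding (tuple n ∘ coords n) := hcomp ▸ IsEmbedding.subtypeVal
  refine ⟨IsEmbedding.of_comp (continuous_coords n) (continuous_tuple n) hemb, ?_⟩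
  have hr : range (coords n) = ⋂ i : Fin n, ⋂ j : Fin n, ⋂ _ : i ≠ j,
      {z | tuple n z i ≠ tuple n z j} := by
    ext z
    simp only [mem_range, mem_iInter, mem_ofPred_eq]
    constructor
    · rintro ⟨X, rfl⟩ i j hij
      rw [tuple_coords]
      exact X.2.1.ne hij
    · intro h
      refine ⟨⟨tuple n z, fun i j hij => by_contra fun hne => h i j hne hij, tuple_fixed n z⟩,
        coords_tuple n z _⟩
  rw [hr]
  refine isOpen_iInter_of_finite fun i => isOpen_iInter_of_finite fun j =>
    isOpen_iInter_of_finite fun _ => ?_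
  exact isOpen_ne_fun ((continuous_apply i).comp (continuous_tuple n))
    ((continuous_apply j).comp (continuous_tuple n))

/-- `M_{0,n}` is a complex manifold with the global chart `(x₁, …, xₙ₋₃)`. -/
instance (n : ℕ) : ChartedSpace (Fin (n - 3) → ℂ) (M0 n) :=
  (isOpenEmbedding_coords n).singletonChartedSpace

/-! ### Geometric bases -/

/-- `g : [0, 1] → ℂ` is smooth at `t` with non-zero velocity. -/
def SmoothRegularAt (g : ℝ → ℂ) (t : ℝ) : Prop :=
  ContDiffWithinAt ℝ ∞ g (Icc 0 1) t ∧ derivWithin g (Icc 0 1) t ≠ 0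

/-- Smooth regular arcs in `ℙ¹`: injective paths that are smooth with non-zero velocity, in the
charts `z` and `w = 1 / z`, at all times including the end points. -/
def IsRegularArc {u v : P1} (a : Path u v) : Prop :=
  Function.Injective a ∧ ∀ t ∈ Icc (0 : ℝ) 1,
    (a.extend t ≠ OnePoint.infty → SmoothRegularAt (zCoord ∘ a.extend) t) ∧
    (a.extend t ≠ ((0 : ℂ) : P1) → SmoothRegularAt (wCoord ∘ a.extend) t)

/-- A system of arcs from `x₀` to the points of `X`, in counterclockwise order around `x₀`,
together with small discs around the points of `X`. -/
structure ArcSystem {n : ℕ} (x : M1 n) where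
  /-- The `i`-th arc ends at the point with index `σ i`. -/
  σ : Equiv.Perm (Fin n)
  /-- The arcs. -/
  arc : ∀ i, Path (x.1 0) ((proj n x).1 (σ i))
  regular : ∀ i, IsRegularArc (arc i)
  /-- Two different arcs meet only at `x₀`. -/
  meet : ∀ i j, i ≠ j → ∀ s t, arc i s = arc j t → s = 0 ∧ t = 0
  /-- Arguments of the tangent vectors at `x₀` (a point of `ℂ`). They increase, within one turn. -/
  angle : Fin n → ℝ
  angle_strictMono : StrictMono angle
  angle_lt : ∀ i j, angle i < angle j + 2 * Real.pi
  tangent : ∀ i, derivWithin (zCoord ∘ (arc i).extend) (Icc 0 1) 0 =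
    (‖derivWithin (zCoord ∘ (arc i).extend) (Icc 0 1) 0‖ : ℂ) *
      Complex.exp ((angle i : ℂ) * Complex.I)
  /-- The radii of the discs. -/
  radius : Fin n → ℝ
  radius_pos : ∀ i, 0 < radius i
  /-- The `i`-th disc contains no point of `X` except its centre. -/
  disc_marked : ∀ i j, (proj n x).1 j ∈ coordDisc ((proj n x).1 (σ i)) (radius i) → j = σ i
  disc_base : ∀ i, x.1 0 ∉ coordDisc ((proj n x).1 (σ i)) (radius i)
  disc_disjoint : ∀ i j, i ≠ j →
    Disjoint (coordDisc ((proj n x).1 (σ i)) (radius i))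
      (coordDisc ((proj n x).1 (σ j)) (radius j))
  /-- The time at which the `i`-th arc reaches the `i`-th circle; the discs are so small that it
  meets the circle only once. -/
  crossing : Fin n → unitInterval
  crossing_iff : ∀ i t, arc i t ∈ coordCircle ((proj n x).1 (σ i)) (radius i) ↔ t = crossing i

/-- `g` is the class of the loop that travels along the `i`-th arc until the `i`-th circle, makes
one complete counterclockwise tour of the circle, and goes back along the arc. -/
def ArcSystem.IsLoopClass {n : ℕ} {x : M1 n} (A : ArcSystem x) (i : Fin n) (g : Nx x) : Prop :=
  ∃ (ζ : ℂ) (z : Punctured (proj n x)) (d : Path (basePoint x) z) (c : Path z z),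
    ‖ζ‖ = A.radius i ∧
    (∀ t, (d t).1 = A.arc i (t * A.crossing i)) ∧
    (∀ t : unitInterval, (c t).1 = fromCoord ((proj n x).1 (A.σ i))
      (ζ * Complex.exp (2 * Real.pi * Complex.I * ((t : ℝ) : ℂ)))) ∧
    g = Pi1.mk (d.trans (c.trans d.symm))

/-- A geometric basis `([α₁], …, [αₙ])` of `N_x = π₁(ℙ¹ - X, x₀)`. -/
structure GeometricBasis {n : ℕ} (x : M1 n) where
  /-- The classes `[αᵢ]`. -/
  cls : Fin n → Nx x
  geometric : ∃ A : ArcSystem x, ∀ i, A.IsLoopClass i (cls i)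
  generates : Subgroup.closure (range cls) = ⊤

/-! ### Data -/

/-- `Γₙ = ⟨γ₁, …, γₙ | γ₁ ⋯ γₙ = 1⟩`. -/
abbrev Gam (n : ℕ) : Type :=
  PresentedGroup ({(List.ofFn fun i : Fin n => FreeGroup.of i).prod} : Set (FreeGroup (Fin n)))

/-- The generator `γᵢ` of `Γₙ`. -/
def Gam.gen {n : ℕ} (i : Fin n) : Gam n := PresentedGroup.of i

/-- An `n`-datum: an epimorphism `θ : Γₙ → G` with `θ(γᵢ) ≠ 1` for all `i`. -/
structure Datum (n : ℕ) (G : Type*) [Group G] where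
  /-- The homomorphism. -/
  hom : Gam n →* G
  surjective : Function.Surjective hom
  gen_ne_one : ∀ i, hom (Gam.gen i) ≠ 1

/-! ### Extensions -/

/-- An extension `a = (H_a, f_a)` of `(N → K → H, f : N → G)`: a subgroup `H_a` of finite index
of `H` and a homomorphism `f_a : p⁻¹(H_a) → G` with `f_a ∘ i = f`. -/
structure Extension {N K H G : Type*} [Group N] [Group K] [Group H] [Group G]
    (i : N →* K) (p : K →* H) (f : N →* G) where
  /-- The subgroup `H_a`. -/
  base : Subgroup H
  finiteIndex : base.FiniteIndex
  /-- The homomorphism `f_a`, defined on `K_a = p⁻¹(H_a)`. -/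
  hom : base.comap p →* G
  hom_incl : ∀ ν : N, ∃ h : i ν ∈ base.comap p, hom ⟨i ν, h⟩ = f ν

/-- The set `I(x, B, θ)` of extensions of `(N_x → K_x → H_X, f)`, where `f : N_x → G` is
`θ ∘ χ⁻¹` and `χ : Γₙ → N_x` is the isomorphism with `χ(γᵢ) = [αᵢ]`. As the `[αᵢ]` generate `N_x`,
`f` is the homomorphism determined by `f([αᵢ]) = θ(γᵢ)`; see `Coll.f_eq` and `Coll.f_unique`. -/
structure Coll {n : ℕ} {G : Type*} [Group G] (x : M1 n) (B : GeometricBasis x)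
    (θ : Datum n G) where
  /-- The homomorphism `f = θ ∘ χ⁻¹`. -/
  f : Nx x →* G
  f_cls : ∀ i, f (B.cls i) = θ.hom (Gam.gen i)
  /-- The extension `a = (H_a, f_a)`. -/
  ext : Extension (iStar x) (pStar x) f

theorem Coll.f_eq {n : ℕ} {G : Type*} [Group G] {x : M1 n} {B : GeometricBasis x}
    {θ : Datum n G} (a : Coll x B θ) (χ : Gam n ≃* Nx x) (hχ : ∀ i, χ (Gam.gen i) = B.cls i) :
    a.f = θ.hom.comp χ.symm.toMonoidHom := by
  have h : a.f.comp χ.toMonoidHom = θ.hom :=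
    PresentedGroup.ext fun i => by
      have := a.f_cls i
      rw [← hχ i] at this
      exact this
  rw [← h]
  ext g
  simp

theorem Coll.f_unique {n : ℕ} {G : Type*} [Group G] {x : M1 n} {B : GeometricBasis x}
    {θ : Datum n G} (a b : Coll x B θ) : a.f = b.f :=
  MonoidHom.eq_of_eqOn_dense B.generates (by
    rintro _ ⟨i, rfl⟩
    rw [a.f_cls, b.f_cls])

/-- `q : (Y, y) → (M_{0,n}, X)` is the pointed covering that defines the base `Y_a` of the family
with index `a`: `Y` is connected, `q_* π₁(Y, y) = H_a`, and `Y` has the complex structure that makes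
`q` locally biholomorphic. -/
structure IsBase {n : ℕ} {G : Type*} [Group G] {x : M1 n} {B : GeometricBasis x} {θ : Datum n G}
    (a : Coll x B θ) {Y : Type*} [TopologicalSpace Y] [ChartedSpace (Fin (n - 3) → ℂ) Y]
    (q : C(Y, M0 n)) (y : Y) : Prop where
  connected : ConnectedSpace Y
  isManifold : IsManifold 𝓘(ℂ, Fin (n - 3) → ℂ) ω Y
  isCoveringMap : IsCoveringMap q
  isLocalBiholomorphism :
    IsLocalDiffeomorph 𝓘(ℂ, Fin (n - 3) → ℂ) 𝓘(ℂ, Fin (n - 3) → ℂ) ω q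
  map_point : q y = proj n x
  range_eq : (pi1Map q map_point).range = a.ext.base

end CoverFamily

end

open CoverFamily
open scoped Manifold ContDiff

open CoverFamily
open scoped Manifold ContDiff

/-! As `G` is abelian, it suffices to extend `f` by a product of winding numbers. Since `xₙ = ∞`,
the coordinate `x₀` is finite on all of `M_{0,n+1}`, so for every finite `xⱼ` the function `x₀ - xⱼ`
is continuous and nowhere zero there, not only on one fibre. Its winding number around `0` is a
homomorphism `K_x → ℤ` (`windingHom`), and `totalHom` multiplies the powers of the `θ(γᵢ)` with
these exponents.

On `[αᵢ]` only the small circle counts, because the tail is traversed both ways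
(`isLogChange_circle`). Around a finite point the circle winds once for its own difference and not
at all for the others, which gives `θ(γᵢ)`. Around `∞` it winds `-1` times for every finite point,
which gives the inverse of the product of the other `θ(γₖ)`. That is again `θ(γᵢ)`, by the relation
`γ₁ ⋯ γₙ = 1` (`prod_zpow_circleWinding`). So `f` extends to all of `K_x`, and `H_a` is the whole
group.

A path connected covering of a path connected space that is surjective on `π₁` is bijective
(`bijective_of_pi1Map_range_eq_top`), and a bijective local biholomorphism is biholomorphic. -/

namespace CoverFamily

/-! ### Winding numbers by lifting paths through `exp` -/

noncomputable section Winding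

open unitInterval

/-- The punctured plane `ℂ ∖ {0}`. -/
abbrev PuncturedPlane : Type := {z : ℂ // z ≠ 0}

variable {Y : Type*} [TopologicalSpace Y] {x y z : Y}

/-- `δ` is the change of a continuous branch of `log h` along the path `γ`. -/
def IsLogChange (h : C(Y, PuncturedPlane)) (γ : Path x y) (δ : ℂ) : Prop :=
  ∃ L : C(I, ℂ), (∀ t, Complex.exp (L t) = (h (γ t)).1) ∧ L 1 - L 0 = δ

/-- Homotopies rel end points lift through the covering `exp`, so two lifts with the same start have
the same end. -/
theorem IsLogChange.of_homotopic {h : C(Y, PuncturedPlane)} {γ γ' : Path x y} {δ δ' : ℂ}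
    (H : IsLogChange h γ δ) (H' : IsLogChange h γ' δ') (hom : γ.Homotopic γ') : δ = δ' := by
  obtain ⟨L, hL, rfl⟩ := H
  obtain ⟨L', hL', rfl⟩ := H'
  have h0 : Complex.exp (L 0) = Complex.exp (L' 0) := by simp [hL, hL']
  -- The translate of `L'` that starts at `L 0`. It is still a logarithm, as the shift lies in the
  -- kernel of `exp`.
  let M : C(I, ℂ) := ⟨fun t => L' t - L' 0 + L 0, by fun_prop⟩
  have key := Complex.isCoveringMap_exp.homotopicRel_iff_comp (f₀ := L) (f₁ := M) (S := {0, 1})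
    ⟨0, by simp, by simp [M]⟩
  have hrel : ContinuousMap.HomotopicRel L M {0, 1} := by
    rw [key]
    have e : (⟨_, Complex.isCoveringMap_exp.continuous⟩ : C(ℂ, PuncturedPlane)).comp L =
        (γ.map h.continuous).toContinuousMap :=
      ContinuousMap.ext fun t => Subtype.ext (hL t)
    have e' : (⟨_, Complex.isCoveringMap_exp.continuous⟩ : C(ℂ, PuncturedPlane)).comp M =
        (γ'.map h.continuous).toContinuousMap :=
      ContinuousMap.ext fun t => Subtype.ext (by
        change Complex.exp (L' t - L' 0 + L 0) = _
        rw [Complex.exp_add, Complex.exp_sub, h0, div_mul_cancel₀ _ (Complex.exp_ne_zero _), hL']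
        rfl)
    rw [e, e']
    exact hom.map h
  obtain ⟨F⟩ := hrel
  have := (F.eq_fst 0 (show (1 : I) ∈ ({0, 1} : Set I) by simp)).symm.trans
    (F.eq_snd 0 (show (1 : I) ∈ ({0, 1} : Set I) by simp))
  simp only [M, ContinuousMap.coe_mk] at this
  rw [this]; ring

theorem exists_isLogChange (h : C(Y, PuncturedPlane)) (γ : Path x y) :
    ∃ δ, IsLogChange h γ δ := by
  obtain ⟨L, hL, -⟩ := Complex.isCoveringMap_exp.exists_path_lifts
    (h.comp γ.toContinuousMap) (Complex.log (h (γ 0)).1)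
    (Subtype.ext (Complex.exp_log (h (γ 0)).2).symm)
  exact ⟨_, L, fun t => congrArg Subtype.val (congrFun hL t), rfl⟩

theorem IsLogChange.symm {h : C(Y, PuncturedPlane)} {γ : Path x y} {δ : ℂ}
    (H : IsLogChange h γ δ) : IsLogChange h γ.symm (-δ) := by
  obtain ⟨L, hL, rfl⟩ := H
  exact ⟨L.comp ⟨σ, by fun_prop⟩, fun t => hL (σ t), by simp⟩

theorem IsLogChange.trans {h : C(Y, PuncturedPlane)} {γ : Path x y} {γ' : Path y z} {δ δ' : ℂ}
    (H : IsLogChange h γ δ) (H' : IsLogChange h γ' δ') :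
    IsLogChange h (γ.trans γ') (δ + δ') := by
  obtain ⟨L, hL, rfl⟩ := H
  obtain ⟨L', hL', rfl⟩ := H'
  have h0 : Complex.exp (L 1) = Complex.exp (L' 0) := by simp [hL, hL']
  let P : Path (L 0) (L 1) := ⟨L, rfl, rfl⟩
  -- The second branch is translated to start where the first one ends.
  let P' : Path (L 1) (L' 1 - L' 0 + L 1) :=
    ⟨⟨fun t => L' t - L' 0 + L 1, by fun_prop⟩, by simp, by simp⟩
  refine ⟨(P.trans P').toContinuousMap, fun t => ?_, ?_⟩
  · change Complex.exp ((P.trans P') t) = _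
    simp only [Path.trans_apply]
    split_ifs
    · exact hL _
    · change Complex.exp (L' _ - L' 0 + L 1) = _
      rw [Complex.exp_add, Complex.exp_sub, h0, div_mul_cancel₀ _ (Complex.exp_ne_zero _), hL']
  · change (P.trans P') 1 - (P.trans P') 0 = _
    rw [Path.target, Path.source]
    ring

theorem IsLogChange.exists_int {h : C(Y, PuncturedPlane)} {γ : Path x x} {δ : ℂ}
    (H : IsLogChange h γ δ) : ∃ k : ℤ, δ = k * (2 * Real.pi * Complex.I) := by
  obtain ⟨L, hL, rfl⟩ := H
  have h0 : Complex.exp (L 1) = Complex.exp (L 0) := by simp [hL]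
  obtain ⟨k, hk⟩ := Complex.exp_eq_exp_iff_exists_int.1 h0
  exact ⟨k, by rw [hk]; ring⟩

/-- `k` is the winding number around `0` of the image under `h` of a loop in the class `g`. -/
def HasWinding (h : C(Y, PuncturedPlane)) (g : Pi1 Y x) (k : ℤ) : Prop :=
  ∃ γ : Path x x, Pi1.mk γ = g ∧ IsLogChange h γ (k * (2 * Real.pi * Complex.I))

theorem Pi1.exists_mk (g : Pi1 Y x) : ∃ γ : Path x x, Pi1.mk γ = g := by
  obtain ⟨γ, hγ⟩ := Path.Homotopic.Quotient.mk_surjective (FundamentalGroup.toPath g.unop)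
  exact ⟨γ, congrArg MulOpposite.op hγ⟩

theorem exists_hasWinding (h : C(Y, PuncturedPlane)) (g : Pi1 Y x) : ∃ k, HasWinding h g k := by
  obtain ⟨γ, hγ⟩ := Pi1.exists_mk g
  obtain ⟨δ, hδ⟩ := exists_isLogChange h γ
  obtain ⟨k, rfl⟩ := hδ.exists_int
  exact ⟨k, γ, hγ, hδ⟩

theorem HasWinding.unique {h : C(Y, PuncturedPlane)} {g : Pi1 Y x} {k l : ℤ}
    (H : HasWinding h g k) (H' : HasWinding h g l) : k = l := by
  obtain ⟨γ, hγ, hk⟩ := H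
  obtain ⟨γ', hγ', hl⟩ := H'
  have e : γ.Homotopic γ' :=
    Path.Homotopic.Quotient.exact (MulOpposite.op_injective (hγ.trans hγ'.symm))
  have := hk.of_homotopic hl e
  exact_mod_cast mul_right_cancel₀ Complex.two_pi_I_ne_zero this

theorem HasWinding.mul {h : C(Y, PuncturedPlane)} {g g' : Pi1 Y x} {k l : ℤ}
    (H : HasWinding h g k) (H' : HasWinding h g' l) : HasWinding h (g * g') (k + l) := by
  obtain ⟨γ, rfl, hk⟩ := H
  obtain ⟨γ', rfl, hl⟩ := H'
  refine ⟨γ.trans γ', rfl, ?_⟩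
  convert hk.trans hl using 1
  push_cast; ring

/-- The winding number around `0` of the image of a loop under `h`. -/
def windingHom (h : C(Y, PuncturedPlane)) (x : Y) : Pi1 Y x →* Multiplicative ℤ :=
  MonoidHom.mk' (fun g => Multiplicative.ofAdd (exists_hasWinding h g).choose) fun g g' =>
    ((exists_hasWinding h (g * g')).choose_spec.unique
      ((exists_hasWinding h g).choose_spec.mul (exists_hasWinding h g').choose_spec))

theorem HasWinding.windingHom_eq {h : C(Y, PuncturedPlane)} {g : Pi1 Y x} {k : ℤ}
    (H : HasWinding h g k) : windingHom h x g = Multiplicative.ofAdd k :=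
  congrArg Multiplicative.ofAdd ((exists_hasWinding h g).choose_spec.unique H)

/-- The contributions of `d` and `d.symm` cancel. The change along `d` itself need not be a multiple
of `2πi`. -/
theorem HasWinding.conj {h : C(Y, PuncturedPlane)} (d : Path x y) {c : Path y y} {k : ℤ}
    (H : IsLogChange h c (k * (2 * Real.pi * Complex.I))) :
    HasWinding h (Pi1.mk (d.trans (c.trans d.symm))) k := by
  obtain ⟨δ, hδ⟩ := exists_isLogChange h d
  refine ⟨_, rfl, ?_⟩
  convert hδ.trans (H.trans hδ.symm) using 1
  ring

theorem pi1Map_mk {Z : Type*} [TopologicalSpace Z] (f : C(Y, Z)) {w : Z} (hf : f x = w)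
    (γ : Path x x) :
    pi1Map f hf (Pi1.mk γ) = Pi1.mk ((γ.map f.continuous).cast hf.symm hf.symm) :=
  congrArg MulOpposite.op
    (FundamentalGroup.mapOfEq_apply f hf (FundamentalGroup.fromPath (.mk γ)))

theorem HasWinding.map {Z : Type*} [TopologicalSpace Z] {h : C(Z, PuncturedPlane)} {f : C(Y, Z)}
    {w : Z} (hf : f x = w) {g : Pi1 Y x} {k : ℤ} (H : HasWinding (h.comp f) g k) :
    HasWinding h (pi1Map f hf g) k := by
  subst hf
  obtain ⟨γ, rfl, L, hL, hk⟩ := H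
  exact ⟨γ.map f.continuous, (pi1Map_mk f rfl γ).symm, L, hL, hk⟩

end Winding

/-! ### Winding along explicit circles -/

section Circles

open unitInterval

/-- A branch of `log (1 + u exp (2πit))`. -/
theorem exists_log_one_add_circle {u : ℂ} (hu : ‖u‖ < 1) : ∃ L : C(I, ℂ),
    (∀ t : I, Complex.exp (L t) =
      1 + u * Complex.exp (2 * Real.pi * Complex.I * ((t : ℝ) : ℂ))) ∧ L 1 = L 0 := by
  have hn : ∀ t : I, ‖u * Complex.exp (2 * Real.pi * Complex.I * ((t : ℝ) : ℂ))‖ < 1 := fun t => by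
    have : (2 * Real.pi * Complex.I * ((t : ℝ) : ℂ)) = ((2 * Real.pi * t : ℝ) : ℂ) * Complex.I := by
      push_cast; ring
    rw [norm_mul, this, Complex.norm_exp_ofReal_mul_I, mul_one]
    exact hu
  -- The values stay in the unit disc around `1`, inside the slit plane, so the principal logarithm
  -- is a closed branch.
  have hs := fun t => Complex.mem_slitPlane_of_norm_lt_one (hn t)
  refine ⟨⟨fun t => Complex.log
    (1 + u * Complex.exp (2 * Real.pi * Complex.I * ((t : ℝ) : ℂ))), ?_⟩, fun t => ?_, ?_⟩
  · exact Continuous.clog (by fun_prop) hs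
  · exact Complex.exp_log (Complex.slitPlane_ne_zero (hs t))
  · simp [Complex.exp_two_pi_mul_I]

variable {Y : Type*} [TopologicalSpace Y] {x y : Y} {h : C(Y, PuncturedPlane)} {c : Path x x}

theorem isLogChange_circle_center {ζ : ℂ} (hζ : ζ ≠ 0)
    (hc : ∀ t : I, (h (c t)).1 = ζ * Complex.exp (2 * Real.pi * Complex.I * ((t : ℝ) : ℂ))) :
    IsLogChange h c ((1 : ℤ) * (2 * Real.pi * Complex.I)) := by
  refine ⟨⟨fun t => Complex.log ζ + 2 * Real.pi * Complex.I * ((t : ℝ) : ℂ), by fun_prop⟩,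
    fun t => ?_, ?_⟩
  · simp [Complex.exp_add, Complex.exp_log hζ, hc]
  · simp

/-- Factor as `w (1 + (ζ / w) e)`, where `e` is the exponential; the second factor does not wind,
since `‖ζ / w‖ < 1`. -/
theorem isLogChange_circle_outside {ζ w : ℂ} (hw : ‖ζ‖ < ‖w‖)
    (hc : ∀ t : I, (h (c t)).1 = w + ζ * Complex.exp (2 * Real.pi * Complex.I * ((t : ℝ) : ℂ))) :
    IsLogChange h c ((0 : ℤ) * (2 * Real.pi * Complex.I)) := by
  have hw0 : 0 < ‖w‖ := (norm_nonneg ζ).trans_lt hw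
  have hw1 : w ≠ 0 := norm_pos_iff.1 hw0
  obtain ⟨L, hL, hL1⟩ := exists_log_one_add_circle (u := ζ / w)
    (by rw [norm_div]; exact (div_lt_one hw0).2 hw)
  refine ⟨⟨fun t => Complex.log w + L t, by fun_prop⟩, fun t => ?_, ?_⟩
  · simp only [ContinuousMap.coe_mk, Complex.exp_add, Complex.exp_log hw1, hL, hc]
    field_simp
  · simp [hL1]

/-- Factor as `(ζ e)⁻¹ (1 - ζ w e)`, where `e` is the exponential: the first factor winds `-1` times
and the second does not wind. -/
theorem isLogChange_circle_infty {ζ w : ℂ} (hζ : ζ ≠ 0) (hw : ‖ζ * w‖ < 1)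
    (hc : ∀ t : I, (h (c t)).1 =
      (ζ * Complex.exp (2 * Real.pi * Complex.I * ((t : ℝ) : ℂ)))⁻¹ - w) :
    IsLogChange h c ((-1 : ℤ) * (2 * Real.pi * Complex.I)) := by
  obtain ⟨L, hL, hL1⟩ := exists_log_one_add_circle (u := -(ζ * w)) (by rwa [norm_neg])
  refine ⟨⟨fun t => -Complex.log ζ - 2 * Real.pi * Complex.I * ((t : ℝ) : ℂ) + L t, by fun_prop⟩,
    fun t => ?_, ?_⟩
  · have := Complex.exp_ne_zero (2 * Real.pi * Complex.I * ((t : ℝ) : ℂ))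
    simp only [ContinuousMap.coe_mk, Complex.exp_add, Complex.exp_sub, Complex.exp_neg,
      Complex.exp_log hζ, hL, hc]
    field_simp
    ring
  · simp only [ContinuousMap.coe_mk, hL1, Icc.coe_one, Icc.coe_zero]
    push_cast
    ring

end Circles

/-! ### Coverings that are surjective on `π₁` -/

section Coverings

theorem isCoveringMap_id {X : Type*} [TopologicalSpace X] : IsCoveringMap (id : X → X) := fun x =>
  IsEvenlyCovered.to_isEvenlyCovered_preimage (I := Unit)
    ⟨inferInstance, univ, mem_univ x, isOpen_univ, isOpen_univ,
      (Homeomorph.prodUnique univ Unit).symm, fun _ => rfl⟩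

theorem pi1Map_id_range {Y : Type*} [TopologicalSpace Y] {y : Y} (h : ContinuousMap.id Y y = y) :
    (pi1Map (ContinuousMap.id Y) h).range = ⊤ := by
  refine eq_top_iff.2 fun g _ => ⟨g, ?_⟩
  obtain ⟨γ, rfl⟩ := Pi1.exists_mk g
  exact pi1Map_mk _ _ γ

/-- For injectivity, two points of one fibre are joined to `y`. The images of the two paths differ
by a loop, which is homotopic to the image of a loop `δ` at `y`, so unique lifting identifies the
end points. Surjectivity is path lifting. -/
theorem bijective_of_pi1Map_range_eq_top {Y X : Type*} [TopologicalSpace Y]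
    [TopologicalSpace X] [PathConnectedSpace Y] [PathConnectedSpace X] {q : C(Y, X)}
    (hq : IsCoveringMap q) {y : Y} {x : X} (hy : q y = x) (hr : (pi1Map q hy).range = ⊤) :
    Function.Bijective q := by
  subst hy
  constructor
  · intro y₁ y₂ h
    let p₁ := PathConnectedSpace.somePath y y₁
    let p₂ := PathConnectedSpace.somePath y y₂
    let q₁ : Path (q y) (q y₁) := p₁.map q.continuous
    let q₂ : Path (q y) (q y₁) := (p₂.map q.continuous).cast rfl h
    obtain ⟨g, hg⟩ : Pi1.mk (q₁.trans q₂.symm) ∈ (pi1Map q rfl).range := hr ▸ trivial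
    obtain ⟨δ, rfl⟩ := Pi1.exists_mk g
    rw [pi1Map_mk] at hg
    have e1 : Path.Homotopic.Quotient.mk (δ.map q.continuous) =
        Path.Homotopic.Quotient.mk (q₁.trans q₂.symm) := MulOpposite.op_injective hg
    have e2 : Path.Homotopic.Quotient.mk ((δ.map q.continuous).trans q₂) =
        Path.Homotopic.Quotient.mk q₁ := by
      rw [Path.Homotopic.Quotient.mk_trans, e1, Path.Homotopic.Quotient.mk_trans,
        Path.Homotopic.Quotient.mk_symm, Path.Homotopic.Quotient.trans_assoc,
        Path.Homotopic.Quotient.symm_trans, Path.Homotopic.Quotient.trans_refl]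
    have m1 := hq.monodromy_map (Path.Homotopic.Quotient.mk p₁)
    -- The class of `q₁` is also that of the image of `δ.trans p₂`, whose lift from `y` ends at
    -- `y₂`; by `m1` it ends at `y₁`.
    have m2 : hq.monodromy (Path.Homotopic.Quotient.mk q₁) ⟨y, rfl⟩ = ⟨y₂, h.symm⟩ := by
      refine hq.monodromy_eq_of_map_eq (Path.Homotopic.Quotient.mk (δ.trans p₂)) ?_
      rw [← e2]
      exact congrArg Path.Homotopic.Quotient.mk (Path.map_trans δ p₂ q.continuous)
    exact congrArg Subtype.val (m1.symm.trans m2)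
  · intro x
    let p := PathConnectedSpace.somePath (q y) x
    exact ⟨_, (hq.monodromy (Path.Homotopic.Quotient.mk p) ⟨y, rfl⟩).2⟩

end Coverings

/-! ### Path connectedness of `M_{0,n}` -/

section Connectedness

/-- Each condition excludes at most one `t`, and the complement of a countable set in the real plane
`ℂ` is path connected. -/
theorem isPathConnected_ne_affine {ι : Type*} [Finite ι] (a b : ι → ℂ) (h : ∀ i, a i ≠ 0) :
    IsPathConnected {t : ℂ | ∀ i, a i + t * b i ≠ 0} := by
  have hc : (⋃ i, {t : ℂ | a i + t * b i = 0}).Countable := by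
    refine countable_iUnion fun i => Set.Subsingleton.countable fun s hs t ht => ?_
    simp only [mem_ofPred_eq] at hs ht
    have hb : b i ≠ 0 := fun hb => h i (by simpa [hb] using hs)
    exact mul_right_cancel₀ hb (add_left_cancel (hs.trans ht.symm))
  convert hc.isPathConnected_compl_of_one_lt_rank (E := ℂ)
    (by rw [Complex.rank_real_complex]; norm_num) using 1
  ext t
  simp

theorem last_eq_infty {n : ℕ} (X : M0 n) (i : Fin n) (h : ¬ (i : ℕ) + 1 < n) :
    X.1 i = OnePoint.infty := (X.2.2 i).2.2 (by omega)

instance pathConnectedSpace_M0 (n : ℕ) : PathConnectedSpace (M0 n) := by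
  refine ⟨inferInstance, fun X X' => ?_⟩
  let A : Fin n → ℂ := fun i => zCoord (X.1 i)
  let A' : Fin n → ℂ := fun i => zCoord (X'.1 i)
  let ι := {p : Fin n × Fin n // p.1 ≠ p.2 ∧ (p.1 : ℕ) + 1 < n ∧ (p.2 : ℕ) + 1 < n}
  have hne : ∀ (X : M0 n) (p : ι), zCoord (X.1 p.1.1) - zCoord (X.1 p.1.2) ≠ 0 := by
    intro X p hp
    have := congrArg (fun z : ℂ => (z : P1)) (sub_eq_zero.1 hp)
    simp only [coe_zCoord (ne_infty X _ p.2.2.1), coe_zCoord (ne_infty X _ p.2.2.2)] at this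
    exact p.2.1 (X.2.1 this)
  -- The two configurations are joined along a complex line. Finite entries collide only at the
  -- finitely many parameters outside `S`, which a path in `ℂ` from `0` to `1` can avoid.
  let S : Set ℂ := {t : ℂ | ∀ p : ι, (A p.1.1 - A p.1.2) +
    t * ((A' p.1.1 - A p.1.1) - (A' p.1.2 - A p.1.2)) ≠ 0}
  have hS : IsPathConnected S := isPathConnected_ne_affine _ _ (hne X)
  let F : ℂ → Fin n → P1 := fun t i =>
    if (i : ℕ) + 1 < n then ((A i + t * (A' i - A i) : ℂ) : P1) else OnePoint.infty
  have hF : Continuous F := by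
    refine continuous_pi fun i => ?_
    simp only [F]
    split_ifs
    · exact OnePoint.continuous_coe.comp (by fun_prop)
    · exact continuous_const
  have hmem : ∀ t : S, Function.Injective (F t) ∧ ∀ i : Fin n,
      ((i : ℕ) + 3 = n → F t i = ((0 : ℂ) : P1)) ∧ ((i : ℕ) + 2 = n → F t i = ((1 : ℂ) : P1)) ∧
      ((i : ℕ) + 1 = n → F t i = OnePoint.infty) := by
    intro t
    refine ⟨fun i j hij => ?_, fun i => ⟨fun hi => ?_, fun hi => ?_, fun hi => ?_⟩⟩
    · by_contra hne'
      simp only [F] at hij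
      split_ifs at hij with h1 h2
      · refine t.2 ⟨(i, j), hne', h1, h2⟩ ?_
        have := OnePoint.coe_injective hij
        linear_combination this
      · exact OnePoint.coe_ne_infty _ hij
      · exact OnePoint.coe_ne_infty _ hij.symm
      · exact hne' (Fin.ext (by omega))
    · simp only [F, A, A', (X.2.2 i).1 hi, (X'.2.2 i).1 hi]
      rw [if_pos (by omega), sub_self, mul_zero, add_zero]
      rfl
    · simp only [F, A, A', (X.2.2 i).2.1 hi, (X'.2.2 i).2.1 hi]
      rw [if_pos (by omega), sub_self, mul_zero, add_zero]
      rfl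
    · simp only [F]
      rw [if_neg (by omega)]
  have h0 : (0 : ℂ) ∈ S := fun p => by simpa using hne X p
  have h1 : (1 : ℂ) ∈ S := fun p => by
    have := hne X' p
    simp only [A, A']
    ring_nf at this ⊢
    exact this
  let Ψ : S → M0 n := fun t => ⟨F t, hmem t⟩
  have hΨ : Continuous Ψ := Continuous.subtype_mk (hF.comp continuous_subtype_val) _
  have hj := (hS.joinedIn 0 h0 1 h1).joined_subtype.map hΨ
  have e : ∀ (X'' : M0 n) (t : S), (∀ i : Fin n, A i + t * (A' i - A i) = zCoord (X''.1 i)) →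
      Ψ t = X'' := fun X'' t ht => Subtype.ext <| funext fun i => by
    simp only [Ψ, F, ht]
    split_ifs with hi
    · exact coe_zCoord (ne_infty X'' i hi)
    · exact (last_eq_infty X'' i hi).symm
  rwa [e X _ fun i => by simp [A], e X' _ fun i => by simp [A']] at hj

end Connectedness

/-! ### The functions `x₀ - xⱼ` and their winding along the basis loops -/

section Differences

/-- The value `∞` is already taken by `xₙ`. The index `j` ensures that `n` is positive. -/
theorem zeroth_ne_infty {n : ℕ} (x : M1 n) (j : Fin n) : x.1 0 ≠ OnePoint.infty := by
  intro h0
  have h1 := (x.2.2 ⟨n - 1, by have := j.2; omega⟩).2.2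
    (by have := j.2; simp only []; omega)
  exact Fin.succ_ne_zero _ (x.2.1 (h1.trans h0.symm))

theorem continuous_zCoord_comp {Y : Type*} [TopologicalSpace Y] {f : Y → P1} (hf : Continuous f)
    (h : ∀ y, f y ≠ OnePoint.infty) : Continuous fun y => zCoord (f y) := by
  refine (OnePoint.isOpenEmbedding_coe (X := ℂ)).isInducing.continuous_iff.2 ?_
  exact hf.congr fun y => (coe_zCoord (h y)).symm

theorem continuous_eval (n : ℕ) (i : Fin (n + 1)) : Continuous fun x : M1 n => x.1 i :=
  (continuous_apply i).comp continuous_subtype_val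

/-- The function `x₀ - xⱼ` on `M_{0,n+1}`, or the constant `1` if `xⱼ = ∞`. -/
noncomputable def difference {n : ℕ} (j : Fin n) : C(M1 n, PuncturedPlane) where
  toFun x := ⟨if (j : ℕ) + 1 < n then zCoord (x.1 0) - zCoord (x.1 j.succ) else 1, by
    split_ifs with h
    · intro hz
      have hj : x.1 j.succ ≠ OnePoint.infty := ne_infty (proj n x) j h
      have := congrArg (fun z : ℂ => (z : P1)) (sub_eq_zero.1 hz)
      simp only [coe_zCoord (zeroth_ne_infty x j), coe_zCoord hj] at this
      exact Fin.succ_ne_zero j (x.2.1 this).symm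
    · exact one_ne_zero⟩
  continuous_toFun := by
    refine Continuous.subtype_mk ?_ _
    split_ifs with h
    · exact (continuous_zCoord_comp (continuous_eval n 0) fun x => zeroth_ne_infty x j).sub
        (continuous_zCoord_comp (continuous_eval n j.succ) fun x => ne_infty (proj n x) j h)
    · exact continuous_const

theorem difference_fibreIncl {n : ℕ} {X : M0 n} (z : Punctured X) (j : Fin n)
    (h : (j : ℕ) + 1 < n) :
    ((difference j).comp (fibreIncl X) z).1 = zCoord z.1 - zCoord (X.1 j) :=
  if_pos h

theorem difference_of_last {n : ℕ} {X : M0 n} (z : Punctured X) (j : Fin n)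
    (h : ¬ (j : ℕ) + 1 < n) : ((difference j).comp (fibreIncl X) z).1 = 1 :=
  if_neg h

/-- The winding number of the function `x₀ - xⱼ` along a small circle around `xₖ`. -/
def circleWinding {n : ℕ} (k j : Fin n) : ℤ :=
  if (j : ℕ) + 1 < n then if (k : ℕ) + 1 < n then if j = k then 1 else 0 else -1 else 0

theorem fromCoord_infty {ζ : ℂ} (h : ζ ≠ 0) : fromCoord OnePoint.infty ζ = ((ζ⁻¹ : ℂ) : P1) :=
  if_neg h

theorem fromCoord_coe (y ζ : ℂ) : fromCoord (y : P1) ζ = ((y + ζ : ℂ) : P1) := rfl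

theorem mem_coordDisc_coe {y w : ℂ} {r : ℝ} (h : ‖y - w‖ ≤ r) : (w : P1) ∈ coordDisc (y : P1) r :=
  ⟨w - y, by rwa [mem_closedBall_zero_iff, norm_sub_rev], by rw [fromCoord_coe]; simp⟩

theorem mem_coordDisc_infty {w : ℂ} {r : ℝ} (h : 1 ≤ r * ‖w‖) :
    (w : P1) ∈ coordDisc OnePoint.infty r := by
  have hw : w ≠ 0 := by rintro rfl; simp at h; linarith
  refine ⟨w⁻¹, ?_, by rw [fromCoord_infty (inv_ne_zero hw), inv_inv]⟩
  rw [mem_closedBall_zero_iff, norm_inv]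
  exact (inv_le_iff_one_le_mul₀ (norm_pos_iff.2 hw)).2 h

/-- As the disc contains no marked point but its centre, every other one satisfies the strict
inequality needed in `isLogChange_circle_outside` or `isLogChange_circle_infty`. -/
theorem isLogChange_circle {n : ℕ} {X : M0 n} {k : Fin n} {r : ℝ} (hr : 0 < r)
    (hX : ∀ j, X.1 j ∈ coordDisc (X.1 k) r → j = k) {ζ : ℂ} (hζ : ‖ζ‖ = r) {z : Punctured X}
    {c : Path z z} (hc : ∀ t : unitInterval, (c t).1 = fromCoord (X.1 k)
      (ζ * Complex.exp (2 * Real.pi * Complex.I * ((t : ℝ) : ℂ)))) (j : Fin n) :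
    IsLogChange ((difference j).comp (fibreIncl X)) c
      (circleWinding k j * (2 * Real.pi * Complex.I)) := by
  have hζ0 : ζ ≠ 0 := norm_pos_iff.1 (hζ ▸ hr)
  unfold circleWinding
  split_ifs with hj hk hjk
  · subst hjk
    refine isLogChange_circle_center hζ0 fun t => ?_
    rw [difference_fibreIncl _ _ hj, hc, ← coe_zCoord (ne_infty X j hk), fromCoord_coe]
    exact add_sub_cancel_left _ _
  · refine isLogChange_circle_outside (ζ := ζ) (w := zCoord (X.1 k) - zCoord (X.1 j)) ?_ fun t => ?_
    · by_contra hle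
      refine hjk (hX j ?_)
      rw [← coe_zCoord (ne_infty X j hj), ← coe_zCoord (ne_infty X k hk)]
      exact mem_coordDisc_coe (hζ ▸ not_lt.1 hle)
    · rw [difference_fibreIncl _ _ hj, hc, ← coe_zCoord (ne_infty X k hk), fromCoord_coe]
      change zCoord (X.1 k) + _ - _ = zCoord (X.1 k) - _ + _
      ring
  · refine isLogChange_circle_infty (w := zCoord (X.1 j)) hζ0 ?_ fun t => ?_
    · by_contra hle
      refine hk ?_
      rw [← hX j ?_]
      · exact hj
      rw [last_eq_infty X k hk, ← coe_zCoord (ne_infty X j hj)]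
      refine mem_coordDisc_infty ?_
      rw [norm_mul, hζ] at hle
      exact not_lt.1 hle
    · rw [difference_fibreIncl _ _ hj, hc, last_eq_infty X k hk,
        fromCoord_infty (mul_ne_zero hζ0 (Complex.exp_ne_zero _))]
      rfl
  -- The constant function `1` is treated as a circle of radius `0` around `1`.
  · refine isLogChange_circle_outside (ζ := 0) (w := 1) (by simp) fun t => ?_
    rw [difference_of_last _ _ hj]
    simp

theorem ArcSystem.IsLoopClass.windingHom_iStar {n : ℕ} {x : M1 n} {A : ArcSystem x} {i : Fin n}
    {g : Nx x} (h : A.IsLoopClass i g) (j : Fin n) :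
    windingHom (difference j) x (iStar x g) = Multiplicative.ofAdd (circleWinding (A.σ i) j) := by
  obtain ⟨ζ, z, d, c, hζ, -, hc, rfl⟩ := h
  exact ((HasWinding.conj d (isLogChange_circle (A.radius_pos i) (A.disc_marked i) hζ hc j)).map
    (fibreIncl_basePoint x)).windingHom_eq

end Differences

/-! ### The extension of `f` to `K_x` -/

section Extensions

variable {n : ℕ} {G : Type*} [CommGroup G]

theorem Datum.prod_gen (θ : Datum n G) : ∏ i, θ.hom (Gam.gen i) = 1 := by
  have h : (List.ofFn fun i : Fin n => (Gam.gen i : Gam n)).prod = 1 := by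
    have := (PresentedGroup.one_of_mem (rels :=
      {(List.ofFn fun i : Fin n => FreeGroup.of i).prod}) (mem_singleton _))
    rw [map_list_prod, List.map_ofFn] at this
    exact this
  have := congrArg θ.hom h
  rwa [map_list_prod, List.map_ofFn, map_one, List.prod_ofFn] at this

theorem prod_zpow_circleWinding (σ : Equiv.Perm (Fin n)) (g : Fin n → G) (hg : ∏ i, g i = 1)
    (i : Fin n) : ∏ k, g k ^ circleWinding (σ i) (σ k) = g i := by
  by_cases hi : (σ i : ℕ) + 1 < n
  · rw [Finset.prod_eq_single i]
    · simp [circleWinding, hi]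
    · intro k _ hk
      simp [circleWinding, hi, hk]
    · simp
  -- Here `σ i` is the index of `∞`: the exponent is `0` at `k = i` and `-1` elsewhere. The factor
  -- `g i` at `k = i` corrects the full product of inverses, which is `1`.
  · have h : ∀ k, g k ^ circleWinding (σ i) (σ k) = (g k)⁻¹ * if k = i then g i else 1 := by
      intro k
      by_cases hk : k = i
      · subst hk
        simp [circleWinding, hi]
      · have : (σ k : ℕ) + 1 < n := by
          have := Fin.val_ne_of_ne (σ.injective.ne hk)
          omega
        simp [circleWinding, hi, this, hk]
    simp only [h, Finset.prod_mul_distrib, Finset.prod_inv_distrib, hg]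
    simp

/-- The homomorphism `K_x → G` that sends a loop to the product of the `θ(γᵢ)`, with the winding
numbers of the `x₀ - x_{σ(i)}` as exponents. -/
noncomputable def totalHom (x : M1 n) (σ : Equiv.Perm (Fin n)) (θ : Datum n G) : Kx x →* G :=
  ∏ i, (zpowersHom G (θ.hom (Gam.gen i))).comp (windingHom (difference (σ i)) x)

theorem totalHom_iStar {x : M1 n} {A : ArcSystem x} (θ : Datum n G) {i : Fin n} {g : Nx x}
    (h : A.IsLoopClass i g) : totalHom x A.σ θ (iStar x g) = θ.hom (Gam.gen i) := by
  simp only [totalHom, MonoidHom.finsetProd_apply, MonoidHom.comp_apply, h.windingHom_iStar,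
    zpowersHom_apply, toAdd_ofAdd]
  exact prod_zpow_circleWinding A.σ _ θ.prod_gen i

/-- The extension of `θ ∘ χ⁻¹` to all of `K_x`. -/
noncomputable def totalColl (x : M1 n) (B : GeometricBasis x) (θ : Datum n G) (A : ArcSystem x)
    (hA : ∀ i, A.IsLoopClass i (B.cls i)) : Coll x B θ where
  -- Taking `f` as a restriction makes the extension property hold by definition. It is the required
  -- map because its values on the generators `[αᵢ]` are the `θ(γᵢ)`.
  f := (totalHom x A.σ θ).comp (iStar x)
  f_cls i := totalHom_iStar θ (hA i)
  ext :=
    { base := ⊤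
      finiteIndex := inferInstance
      hom := (totalHom x A.σ θ).comp (Subgroup.subtype _)
      hom_incl := fun _ => ⟨trivial, rfl⟩ }

end Extensions

end CoverFamily

theorem theorem9p1 {n : ℕ} (hn : 3 ≤ n) {G : Type*} [CommGroup G] [Finite G]
    (x : M1 n) (B : GeometricBasis x) (θ : Datum n G) :
    ∃ a : Coll x B θ,
      a.ext.base = ⊤ ∧
      IsBase a (ContinuousMap.id (M0 n)) (proj n x) ∧
      ∀ (Y : Type*) [TopologicalSpace Y] [ChartedSpace (Fin (n - 3) → ℂ) Y]
        (q : C(Y, M0 n)) (y : Y), IsBase a q y →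
        ∃ Φ : Diffeomorph 𝓘(ℂ, Fin (n - 3) → ℂ) 𝓘(ℂ, Fin (n - 3) → ℂ) Y (M0 n) ω,
          ⇑Φ = ⇑q := by
  obtain ⟨A, hA⟩ := B.geometric
  refine ⟨totalColl x B θ A hA, rfl, ?_, ?_⟩
  · exact
      { connected := inferInstance
        isManifold := (isOpenEmbedding_coords n).isManifold_singleton
        isCoveringMap := isCoveringMap_id
        isLocalBiholomorphism := (Diffeomorph.refl _ (M0 n) ω).isLocalDiffeomorph
        map_point := rfl
        range_eq := pi1Map_id_range rfl }
  · intro Y _ _ q y hq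
    have := hq.connected
    -- Charts make `Y` locally path connected, so connectedness of `Y` yields the path connectedness
    -- that monodromy needs.
    have := ChartedSpace.locallyPathConnectedSpace (Fin (n - 3) → ℂ) Y
    have : PathConnectedSpace Y := pathConnectedSpace_iff_connectedSpace.2 inferInstance
    exact ⟨hq.isLocalBiholomorphism.diffeomorphOfBijective
      (bijective_of_pi1Map_range_eq_top hq.isCoveringMap hq.map_point hq.range_eq), rfl⟩
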